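/- Let $p$ be a prime, let $H>0$, and let $\{X_n\}_{n\in\mathbb N_0}$ be a real-valued stochastic process on a probability space $(\Omega,\mathcal F,\mathbb P)$ with $\mathbb E(|X_1|^2)<\infty$. Write $\overset{d}{=}$ for equality of the joint distributions of two families, $e(x)=e^{2\pi i x}$, and $|n|_p$ for the $p$-adic norm of $n$. Then $\{X_n\}$ is self-similar with scaling function $b(n)=|n|_p^H$ and has stationary increments (that is, $\{X_{nm}\}_{m\in\mathbb N_0}\overset{d}{=}\{|n|_p^H X_m\}_{m\in\mathbb N_0}$ for every integer $n\ge 1$, and $\{X_{m+1}-X_m\}_{m\in\mathbb N_0}\overset{d}{=}\{X_{m+k+1}-X_{m+k}\}_{m\in\mathbb N_0}$ for every integer $k\ge1$; such a process is called dt-ss-si of type II with scaling function $b(n)=|n|_p^H$) if and only if there is a family $\{A^{(m)}_\ell\}_{m\ge 1,\;0<\ell<p^m,\;p\nmid\ell}$ of pairwise orthogonal elements of the complex space $L^2(\Omega,\mathcal F,\mathbb P)$ such that $$X_n=\sum_{m=1}^\infty\ \sum_{0<\ell<p^m,\ p\nmid \ell}A^{(m)}_\ell\left(e\!\left(\frac{n\ell}{p^m}\right)-1\right)\quad\text{for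 every } n\in\mathbb N_0,$$ where the partial sums in $m$ converge in $L^2(\Omega,\mathcal F,\mathbb P)$, and such that, with all families indexed by $m\ge1$, $0<\ell<p^m$, $p\nmid\ell$: 1. $\displaystyle\{A^{(m)}_\ell\}\overset{d}{=}\left\{e\!\left(\frac{\ell}{p^m}\right)A^{(m)}_\ell\right\}$; 2. for every prime $q\neq p$, $\displaystyle\{A^{(m)}_\ell\}\overset{d}{=}\{A^{(m)}_{[q\ell]}\}$, where $[q\ell]$ is the residue of $q\ell$ modulo $p^m$; 3. $\displaystyle\{p^{-H}A^{(m)}_\ell\}\overset{d}{=}\left\{\sum_{t=0}^{p-1}A^{(m+1)}_{tp^m+\ell}\right\}$. -/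

import Mathlib

open MeasureTheory ProbabilityTheory Filter Topology

noncomputable section

namespace DtSsSi

/-- Discrete-time self-similarity of a real process on `ℕ` with scaling function `b`:
for every `n ≥ 1`, `b n > 0` and the processes `m ↦ X (n * m)` and `m ↦ b n * X m`
have the same (joint) distribution on the path space `ℕ → ℝ`. -/
def IsSelfSimilar {Ω : Type*} [MeasurableSpace Ω] (μ : Measure Ω)
    (X : ℕ → Ω → ℝ) (b : ℕ → ℝ) : Prop :=
  ∀ n : ℕ, 1 ≤ n → 0 < b n ∧
    IdentDistrib (fun ω (m : ℕ) => X (n * m) ω) (fun ω (m : ℕ) => b n * X m ω) μ μ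

/-- Stationary increments: the increment process has the same (joint) distribution as each
of its shifts. -/
def HasStationaryIncrements {Ω : Type*} [MeasurableSpace Ω] (μ : Measure Ω)
    (X : ℕ → Ω → ℝ) : Prop :=
  ∀ k : ℕ, 1 ≤ k →
    IdentDistrib (fun ω (m : ℕ) => X (m + 1) ω - X m ω)
      (fun ω (m : ℕ) => X (m + k + 1) ω - X (m + k) ω) μ μ

/-- A dt-ss-si process with scaling function `b`: discrete-time, self-similar with scaling
function `b`, with stationary increments. -/
def IsDtSsSi {Ω : Type*} [MeasurableSpace Ω] (μ : Measure Ω)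
    (X : ℕ → Ω → ℝ) (b : ℕ → ℝ) : Prop :=
  IsSelfSimilar μ X b ∧ HasStationaryIncrements μ X

/-- The type II scaling function `n ↦ |n|_p ^ H`, where `|·|_p` is the `p`-adic norm. -/
def typeIIScaling (p : ℕ) (H : ℝ) (n : ℕ) : ℝ :=
  ((padicNorm p (n : ℚ) : ℚ) : ℝ) ^ H

/-- `e x = exp (2 π i x)`. -/
def e (x : ℝ) : ℂ :=
  Complex.exp (2 * (Real.pi : ℂ) * Complex.I * (x : ℂ))

/-- The numbers `0 < ℓ < p ^ m` that are not divisible by `p`. -/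
def layer (p m : ℕ) : Finset ℕ :=
  (Finset.Ioo 0 (p ^ m)).filter (fun l => ¬ p ∣ l)

/-- The index set of the coefficients: pairs `(m, ℓ)` with `m ≥ 1`, `0 < ℓ < p ^ m`, `p ∤ ℓ`. -/
abbrev Index (p : ℕ) : Type :=
  {i : ℕ × ℕ // 1 ≤ i.1 ∧ i.2 ∈ layer p i.1}

end DtSsSi

end

namespace DtSsSi

/-! For `d ≥ 1` a type II process satisfies `‖X (n + d) - X n‖ = |d|_p ^ H * ‖X 1‖` in `L²`. As `H >
0`, the sequence `X` is `p`-adically uniformly continuous, so it behaves like a continuous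
`L²`-valued function on the `p`-adic integers. Its Fourier coefficients are the limits of the
averages of `e (-n l / p ^ m) • X n` over `0 ≤ n < p ^ N`, which exist by
`PadicUniformContinuous.exists_tendsto_avg`; these are the `A m l`. Finite Fourier inversion modulo
`p ^ M` together with uniform continuity gives the series
(`PadicUniformContinuous.tendsto_sum_layer`), and the term `-1` reflects `X 0 = 0` almost surely.

Each symmetry of the process corresponds to one of the coefficients: translation to rotation,
multiplication by a prime `q ≠ p` to a permutation of indices, multiplication by `p` to summation
over the lifts of an index. Equality of laws passes both ways because coefficients and process are
limits in measure of the same measurable functionals of one another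
(`identDistrib_of_tendstoInMeasure`). Multiplicativity of the scaling function reduces
self-similarity to primes. Orthogonality follows from rotation invariance, which multiplies each
mixed second moment by a number other than `1`. -/

/-! ### Limits of identically distributed families -/

/-- If two identically distributed families are transformed by the same measurable functionals and
the results converge in measure, then the limits are identically distributed. -/
theorem identDistrib_of_tendstoInMeasure {Ω Ω' α ι E : Type*} [MeasurableSpace Ω]
    [MeasurableSpace Ω'] [MeasurableSpace α] [Countable ι] [MetricSpace E] [CompleteSpace E]
    [SecondCountableTopology E] [MeasurableSpace E] [BorelSpace E] [Nonempty E]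
    {μ : Measure Ω} {ν : Measure Ω'} {U : Ω → α} {V : Ω' → α} (hUV : IdentDistrib U V μ ν)
    {G : ℕ → ι → α → E} (hG : ∀ N i, Measurable (G N i)) {u : Ω → ι → E} {v : Ω' → ι → E}
    (hu : ∀ i, TendstoInMeasure μ (fun N ω => G N i (U ω)) atTop (fun ω => u ω i))
    (hv : ∀ i, TendstoInMeasure ν (fun N ω => G N i (V ω)) atTop (fun ω => v ω i)) :
    IdentDistrib u v μ ν := by
  have key : ∀ i, ∃ ns : ℕ → ℕ,
      (∀ᵐ ω ∂μ, Tendsto (fun k => G (ns k) i (U ω)) atTop (𝓝 (u ω i))) ∧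
      (∀ᵐ ω ∂ν, Tendsto (fun k => G (ns k) i (V ω)) atTop (𝓝 (v ω i))) := by
    intro i
    -- The second extraction takes place inside the first, so one subsequence, and hence one limit
    -- functional, serves both sides.
    obtain ⟨a, ha, hau⟩ := (hu i).exists_seq_tendsto_ae
    obtain ⟨b, hb, hbv⟩ := ((hv i).comp ha.tendsto_atTop).exists_seq_tendsto_ae
    refine ⟨a ∘ b, ?_, hbv⟩
    filter_upwards [hau] with ω hω using hω.comp hb.tendsto_atTop
  choose ns hnu hnv using key
  -- Where the sequence diverges `limUnder` takes a default value; this keeps `F` measurable and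
  -- matters only on null sets.
  let F : α → ι → E := fun a i => limUnder atTop (fun k => G (ns i k) i a)
  have hF : Measurable F := measurable_pi_lambda _ fun i =>
    (StronglyMeasurable.limUnder (l := atTop)
      (f := fun k a => G (ns i k) i a) fun k => (hG (ns i k) i).stronglyMeasurable).measurable
  have h1 : (F ∘ U) =ᵐ[μ] u := by
    filter_upwards [ae_all_iff.2 hnu] with ω hω
    funext i
    exact (hω i).limUnder_eq
  have h2 : (F ∘ V) =ᵐ[ν] v := by
    filter_upwards [ae_all_iff.2 hnv] with ω hω
    funext i
    exact (hω i).limUnder_eq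
  have h := hUV.comp hF
  exact ((IdentDistrib.of_ae_eq h.aemeasurable_fst h1).symm.trans h).trans
    (IdentDistrib.of_ae_eq h.aemeasurable_snd h2)

/-! ### The exponential -/

theorem e_add (x y : ℝ) : e (x + y) = e x * e y := by
  simp only [e, ← Complex.exp_add]
  push_cast
  ring_nf

theorem e_eq_one_iff {x : ℝ} : e x = 1 ↔ ∃ k : ℤ, x = k := by
  rw [e, Complex.exp_eq_one_iff]
  have h : (2 * (Real.pi : ℂ) * Complex.I) ≠ 0 := Complex.two_pi_I_ne_zero
  refine exists_congr fun k => ?_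
  rw [mul_comm (k : ℂ), mul_right_inj' h]
  norm_cast

theorem e_zero : e 0 = 1 := e_eq_one_iff.2 ⟨0, by simp⟩

theorem e_eq_of_sub_eq_intCast {x y : ℝ} (k : ℤ) (h : x - y = k) : e x = e y := by
  rw [show x = (x - y) + y by ring, e_add, e_eq_one_iff.2 ⟨k, h⟩, one_mul]

theorem norm_e (x : ℝ) : ‖e x‖ = 1 := by
  rw [e, show 2 * (Real.pi : ℂ) * Complex.I * x = ((2 * Real.pi * x : ℝ) : ℂ) * Complex.I by
    push_cast; ring]
  exact Complex.norm_exp_ofReal_mul_I _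

theorem conj_e (x : ℝ) : (starRingEnd ℂ) (e x) = e (-x) := by
  rw [e, e, ← Complex.exp_conj]
  simp [Complex.conj_ofNat]

theorem e_nat_mul (n : ℕ) (x : ℝ) : e (n * x) = e x ^ n := by
  rw [e, e, ← Complex.exp_nat_mul]
  push_cast
  ring_nf

/-- Orthogonality of the characters of `ℤ / P`. -/
theorem sum_range_e {P : ℕ} (hP : 0 < P) (k : ℤ) :
    ∑ l ∈ Finset.range P, e ((l : ℝ) * (k / P)) = if (P : ℤ) ∣ k then (P : ℂ) else 0 := by
  have hP' : (P : ℝ) ≠ 0 := by positivity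
  simp only [e_nat_mul]
  have h1 : e ((k : ℝ) / P) = 1 ↔ (P : ℤ) ∣ k := by
    rw [e_eq_one_iff]
    refine exists_congr fun c => ?_
    rw [div_eq_iff hP', mul_comm]
    norm_cast
  split_ifs with h
  · simp [h1.2 h]
  · rw [geom_sum_eq (mt h1.1 h), ← e_nat_mul, mul_div_cancel₀ _ hP',
      e_eq_one_iff.2 ⟨k, rfl⟩]
    simp

/-! ### Sums over residues -/

theorem sum_range_mul {M : Type*} [AddCommMonoid M] (P Q : ℕ) (f : ℕ → M) :
    ∑ n ∈ Finset.range (P * Q), f n =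
      ∑ r ∈ Finset.range P, ∑ t ∈ Finset.range Q, f (r + t * P) := by
  induction Q with
  | zero => simp
  | succ Q ih =>
    rw [Nat.mul_succ, Finset.sum_range_add, ih, ← Finset.sum_add_distrib]
    refine Finset.sum_congr rfl fun r _ => ?_
    rw [Finset.sum_range_succ, mul_comm P Q, add_comm (Q * P)]

/-- A unit acts injectively on residues, so it permutes every finite set of residues that it maps
into itself. -/
theorem sum_mul_mod {M : Type*} [AddCommMonoid M] {P q : ℕ} (hq : Nat.Coprime q P)
    {s : Finset ℕ} (hs : s ⊆ Finset.range P) (h : ∀ l ∈ s, q * l % P ∈ s) (g : ℕ → M) :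
    ∑ l ∈ s, g (q * l % P) = ∑ l ∈ s, g l := by
  have hinj : Set.InjOn (fun l => q * l % P) s := by
    intro a ha b hb hab
    have h1 : q * a ≡ q * b [MOD P] := hab
    have h2 : a ≡ b [MOD P] := Nat.ModEq.cancel_left_of_coprime (by simpa using hq.symm) h1
    exact Nat.ModEq.eq_of_lt_of_lt h2 (Finset.mem_range.1 (hs ha)) (Finset.mem_range.1 (hs hb))
  refine Finset.sum_nbij (fun l => q * l % P) h hinj ?_ fun _ _ => rfl
  exact Finset.surjOn_of_injOn_of_card_le _ h hinj le_rfl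

theorem layer_eq (p m : ℕ) : layer p m = (Finset.range (p ^ m)).filter (fun l => ¬ p ∣ l) := by
  ext l
  simp only [layer, Finset.mem_filter, Finset.mem_Ioo, Finset.mem_range]
  refine ⟨fun h => ⟨h.1.2, h.2⟩, fun h => ⟨⟨Nat.pos_of_ne_zero ?_, h.1⟩, h.2⟩⟩
  rintro rfl
  exact h.2 (dvd_zero p)

theorem mul_mod_mem_layer {p q m l : ℕ} (hp : p.Prime) (hq : Nat.Coprime q p) (hm : 1 ≤ m)
    (hl : l ∈ layer p m) : q * l % p ^ m ∈ layer p m := by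
  rw [layer_eq, Finset.mem_filter, Finset.mem_range] at hl ⊢
  refine ⟨Nat.mod_lt _ (pow_pos hp.pos m), ?_⟩
  rw [Nat.dvd_mod_iff (dvd_pow_self p (by omega)), hq.symm.dvd_mul_left]
  exact hl.2

theorem sum_layer_mul_mod {M : Type*} [AddCommMonoid M] {p q m : ℕ} (hp : p.Prime)
    (hq : Nat.Coprime q p) (hm : 1 ≤ m) (g : ℕ → M) :
    ∑ l ∈ layer p m, g (q * l % p ^ m) = ∑ l ∈ layer p m, g l :=
  sum_mul_mod (hq.pow_right m) (by rw [layer_eq]; exact Finset.filter_subset _ _)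
    (fun _ hl => mul_mod_mem_layer hp hq hm hl) g

theorem add_mem_layer {p m t l : ℕ} (hm : 1 ≤ m) (ht : t < p) (hl : l ∈ layer p m) :
    t * p ^ m + l ∈ layer p (m + 1) := by
  rw [layer_eq, Finset.mem_filter, Finset.mem_range] at hl ⊢
  refine ⟨?_, ?_⟩
  · calc t * p ^ m + l < t * p ^ m + p ^ m := by omega
      _ = (t + 1) * p ^ m := by ring
      _ ≤ p * p ^ m := Nat.mul_le_mul_right _ ht
      _ = p ^ (m + 1) := by ring
  · rw [Nat.dvd_add_right ((dvd_pow_self p (by omega)).mul_left t)]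
    exact hl.2

/-- The inner sums run over the fibres of reduction modulo `p ^ m`. Since `1 ≤ m`, divisibility by
`p` is constant on each fibre. -/
theorem sum_layer_succ {M : Type*} [AddCommMonoid M] {p m : ℕ} (hm : 1 ≤ m) (g : ℕ → M) :
    ∑ l ∈ layer p (m + 1), g l =
      ∑ l ∈ layer p m, ∑ t ∈ Finset.range p, g (t * p ^ m + l) := by
  rw [layer_eq, layer_eq, Finset.sum_filter, Finset.sum_filter, pow_succ, sum_range_mul]
  refine Finset.sum_congr rfl fun r _ => ?_
  have h : ∀ t, p ∣ r + t * p ^ m ↔ p ∣ r := fun t =>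
    Nat.dvd_add_left ((dvd_pow_self p (by omega)).mul_left t)
  simp only [h, add_comm _ r]
  split_ifs <;> simp

/-- The residues modulo `p ^ (m + 1)` are the top layer together with the multiples of `p`. -/
theorem sum_range_pow_succ {M : Type*} [AddCommMonoid M] {p : ℕ} (hp : 0 < p) (m : ℕ) (g : ℕ → M) :
    ∑ l ∈ Finset.range (p ^ (m + 1)), g l =
      ∑ l ∈ layer p (m + 1), g l + ∑ l ∈ Finset.range (p ^ m), g (p * l) := by
  rw [layer_eq, ← Finset.sum_filter_not_add_sum_filter (Finset.range (p ^ (m + 1))) (p ∣ ·)]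
  congr 1
  symm
  refine Finset.sum_nbij (p * ·) ?_ ?_ ?_ fun _ _ => rfl
  · intro l hl
    simp only [Finset.mem_filter, Finset.mem_range] at hl ⊢
    exact ⟨by rw [pow_succ']; exact Nat.mul_lt_mul_of_pos_left hl hp, dvd_mul_right _ _⟩
  · intro a _ b _ hab
    exact Nat.eq_of_mul_eq_mul_left hp hab
  · intro l hl
    simp only [Finset.coe_filter, Finset.mem_range, Set.mem_ofPred_eq] at hl
    obtain ⟨hl, c, rfl⟩ := hl
    refine ⟨c, ?_, rfl⟩
    rw [pow_succ'] at hl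
    simpa using Nat.lt_of_mul_lt_mul_left hl

/-! ### Averages of `p`-adically uniformly continuous sequences -/

theorem tendsto_zero_of_norm_le {E : Type*} [NormedAddCommGroup E] {F : ℕ → E}
    (h : ∀ ε > 0, ∃ K, ∀ N ≥ K, ‖F N‖ ≤ ε) : Tendsto F atTop (𝓝 0) := by
  rw [Metric.tendsto_atTop]
  intro ε hε
  obtain ⟨K, hK⟩ := h (ε / 2) (half_pos hε)
  refine ⟨K, fun N hN => ?_⟩
  rw [dist_zero_right]
  exact (hK N hN).trans_lt (half_lt_self hε)

section Average

variable {E : Type*} [NormedAddCommGroup E] [NormedSpace ℂ E]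

/-- The average of a sequence over `0 ≤ n < p ^ N`. -/
noncomputable def avg (p N : ℕ) (f : ℕ → E) : E :=
  ((p : ℂ) ^ N)⁻¹ • ∑ n ∈ Finset.range (p ^ N), f n

/-- Uniform continuity of a sequence with respect to the `p`-adic metric. -/
def PadicUniformContinuous (p : ℕ) (f : ℕ → E) : Prop :=
  ∀ ε > 0, ∃ K, ∀ n j, ‖f (n + j * p ^ K) - f n‖ ≤ ε

theorem avg_sub (p N : ℕ) (f g : ℕ → E) :
    avg p N (fun n => f n - g n) = avg p N f - avg p N g := by
  simp [avg, Finset.sum_sub_distrib, smul_sub]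

theorem norm_avg_le {p N : ℕ} (hp : 0 < p) {f : ℕ → E} {C : ℝ} (h : ∀ n, ‖f n‖ ≤ C) :
    ‖avg p N f‖ ≤ C := by
  have hP : (0 : ℝ) < (p : ℝ) ^ N := by positivity
  rw [avg, norm_smul, norm_inv, norm_pow, Complex.norm_natCast, inv_mul_le_iff₀ hP]
  refine (norm_sum_le_of_le _ fun n _ => h n).trans ?_
  simp

/-- Writing `n = r + t * p ^ K` isolates the average inside each residue class, where a uniformly
continuous sequence oscillates little. -/
theorem avg_eq_avg_of_le {p N K : ℕ} (h : K ≤ N) (f : ℕ → E) :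
    avg p N f = avg p K (fun r => avg p (N - K) (fun t => f (r + t * p ^ K))) := by
  obtain ⟨Q, rfl⟩ := Nat.exists_eq_add_of_le h
  simp only [avg, Nat.add_sub_cancel_left, ← Finset.smul_sum, smul_smul]
  rw [pow_add p K Q, sum_range_mul, pow_add, mul_inv]

theorem avg_const {p N : ℕ} (hp : 0 < p) (c : E) : avg p N (fun _ => c) = c := by
  have hP : (p : ℂ) ^ N ≠ 0 := pow_ne_zero _ (by exact_mod_cast hp.ne')
  simp only [avg, Finset.sum_const, Finset.card_range, ← Nat.cast_smul_eq_nsmul ℂ, smul_smul]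
  push_cast
  rw [inv_mul_cancel₀ hP, one_smul]

theorem norm_avg_sub_avg_le {p N K : ℕ} (hp : 0 < p) (hN : K ≤ N) {f : ℕ → E} {ε : ℝ}
    (h : ∀ n j, ‖f (n + j * p ^ K) - f n‖ ≤ ε) : ‖avg p N f - avg p K f‖ ≤ ε := by
  rw [avg_eq_avg_of_le hN, ← avg_sub]
  refine norm_avg_le hp fun r => ?_
  have : f r = avg p (N - K) (fun _ => f r) := (avg_const hp _).symm
  rw [this, ← avg_sub]
  exact norm_avg_le hp fun t => h r t

/-- The limit plays the role of the Haar integral over the `p`-adic integers; `norm_avg_sub_avg_le`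
makes the averages Cauchy. -/
theorem PadicUniformContinuous.exists_tendsto_avg [CompleteSpace E] {p : ℕ} (hp : 0 < p)
    {f : ℕ → E} (hf : PadicUniformContinuous p f) :
    ∃ a, Tendsto (fun N => avg p N f) atTop (𝓝 a) := by
  refine cauchySeq_tendsto_of_complete (Metric.cauchySeq_iff'.2 fun ε hε => ?_)
  obtain ⟨K, hK⟩ := hf (ε / 2) (half_pos hε)
  refine ⟨K, fun N hN => ?_⟩
  rw [dist_eq_norm]
  exact (norm_avg_sub_avg_le hp hN hK).trans_lt (half_lt_self hε)

/-- The limiting average is invariant under translation. -/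
theorem PadicUniformContinuous.tendsto_avg_succ {p : ℕ} (hp : 1 < p) {f : ℕ → E}
    (hf : PadicUniformContinuous p f) {a : E} (ha : Tendsto (fun N => avg p N f) atTop (𝓝 a)) :
    Tendsto (fun N => avg p N (fun n => f (n + 1))) atTop (𝓝 a) := by
  have h0 : Tendsto (fun N => avg p N (fun n => f (n + 1)) - avg p N f) atTop (𝓝 0) := by
    obtain ⟨K, hK⟩ := hf 1 one_pos
    have hlim : Tendsto (fun N : ℕ => ((p : ℝ) ^ N)⁻¹) atTop (𝓝 0) :=
      (tendsto_pow_atTop_atTop_of_one_lt (by exact_mod_cast hp)).inv_tendsto_atTop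
    refine squeeze_zero_norm' ?_ hlim
    filter_upwards [eventually_ge_atTop K] with N hN
    -- The difference telescopes to `p ^ (-N) • (f (p ^ N) - f 0)`, whose second factor has norm at
    -- most `1` once `N ≥ K`.
    rw [← avg_sub, avg, Finset.sum_range_sub, norm_smul, norm_inv, norm_pow,
      Complex.norm_natCast]
    obtain ⟨Q, rfl⟩ := Nat.exists_eq_add_of_le hN
    refine mul_le_of_le_one_right (by positivity) ?_
    have := hK 0 (p ^ Q)
    rwa [zero_add, ← pow_add, add_comm Q] at this
  simpa using h0.add ha

/-- The limiting average is invariant under multiplication by a unit. -/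
theorem PadicUniformContinuous.tendsto_avg_mul {p q : ℕ} (hp : 0 < p) (hq : Nat.Coprime q p)
    {f : ℕ → E} (hf : PadicUniformContinuous p f) {a : E}
    (ha : Tendsto (fun N => avg p N f) atTop (𝓝 a)) :
    Tendsto (fun N => avg p N (fun n => f (q * n))) atTop (𝓝 a) := by
  have h0 : Tendsto (fun N => avg p N (fun n => f (q * n)) - avg p N f) atTop (𝓝 0) := by
    refine tendsto_zero_of_norm_le fun ε hε => ?_
    obtain ⟨K, hK⟩ := hf ε hε
    refine ⟨K, fun N hN => ?_⟩
    -- Multiplication by `q` permutes the residues modulo `p ^ N`, and replacing `q * n` by its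
    -- residue changes `f` by at most `ε`.
    have h1 : avg p N f = avg p N (fun n => f (q * n % p ^ N)) := by
      simp only [avg]
      rw [sum_mul_mod (hq.pow_right N) subset_rfl fun l _ =>
        Finset.mem_range.2 (Nat.mod_lt _ (pow_pos hp N))]
    rw [h1, ← avg_sub]
    refine norm_avg_le hp fun n => ?_
    obtain ⟨Q, rfl⟩ := Nat.exists_eq_add_of_le hN
    have := hK (q * n % p ^ (K + Q)) (q * n / p ^ (K + Q) * p ^ Q)
    rwa [mul_assoc _ (p ^ Q), ← pow_add, add_comm Q, Nat.mod_add_div'] at this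
  simpa using h0.add ha

/-! ### Fourier coefficients -/

/-- The character `n ↦ e (- n l / p ^ m)`. -/
noncomputable def chr (p m l n : ℕ) : ℂ := e (-((n : ℝ) * l / (p : ℝ) ^ m))

theorem norm_chr (p m l n : ℕ) : ‖chr p m l n‖ = 1 := norm_e _

theorem chr_add_mul_pow {p m K : ℕ} (hp : 0 < p) (hK : m ≤ K) (l n j : ℕ) :
    chr p m l (n + j * p ^ K) = chr p m l n := by
  obtain ⟨Q, rfl⟩ := Nat.exists_eq_add_of_le hK
  refine e_eq_of_sub_eq_intCast (-(j * p ^ Q * l : ℕ) : ℤ) ?_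
  have : (p : ℝ) ≠ 0 := by positivity
  push_cast
  field_simp
  ring

theorem PadicUniformContinuous.chr_smul {p : ℕ} (hp : 0 < p) {f : ℕ → E}
    (hf : PadicUniformContinuous p f) (m l : ℕ) :
    PadicUniformContinuous p (fun n => chr p m l n • f n) := by
  intro ε hε
  obtain ⟨K, hK⟩ := hf ε hε
  refine ⟨K + m, fun n j => ?_⟩
  simp only []
  rw [chr_add_mul_pow hp (Nat.le_add_left m K), ← smul_sub, norm_smul, norm_chr, one_mul]
  have := hK n (j * p ^ m)
  rwa [mul_assoc, ← pow_add, add_comm m] at this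

theorem sum_range_chr {p m l N : ℕ} (hp : 0 < p) (hm : m ≤ N) (hl : ¬ p ^ m ∣ l) :
    ∑ n ∈ Finset.range (p ^ N), chr p m l n = 0 := by
  obtain ⟨Q, rfl⟩ := Nat.exists_eq_add_of_le hm
  rw [pow_add, sum_range_mul]
  simp only [chr_add_mul_pow hp le_rfl]
  rw [Finset.sum_comm]
  have h := sum_range_e (pow_pos hp m) (-(l : ℤ))
  rw [if_neg (by rw [dvd_neg]; exact_mod_cast hl)] at h
  refine Finset.sum_eq_zero fun _ _ => ?_
  rw [← h]
  refine Finset.sum_congr rfl fun n _ => ?_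
  rw [chr]
  congr 1
  push_cast
  ring

/-- The extra factor is a character of `ℤ / p` in `t`, so summing over `t` detects whether `p ∣ s`.
-/
theorem chr_mul_pow_add {p m : ℕ} (hp : 0 < p) (l t s : ℕ) :
    chr p (m + 1) (t * p ^ m + l) s = chr p (m + 1) l s * e ((t : ℝ) * ((-s : ℤ) / p)) := by
  rw [chr, chr, ← e_add]
  congr 1
  have hp' : (p : ℝ) ≠ 0 := by positivity
  push_cast
  field_simp
  ring

/-- The Fourier coefficients of `s ↦ f (p * s)` are obtained by periodisation. -/
theorem sum_avg_succ {p : ℕ} (hp : 0 < p) (m l N : ℕ) (f : ℕ → E) :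
    ∑ t ∈ Finset.range p, avg p (N + 1) (fun s => chr p (m + 1) (t * p ^ m + l) s • f s) =
      avg p N (fun s => chr p m l s • f (p * s)) := by
  have hp' : (p : ℂ) ≠ 0 := by exact_mod_cast hp.ne'
  have hpr : (p : ℝ) ≠ 0 := by exact_mod_cast hp.ne'
  simp only [avg, ← Finset.smul_sum]
  rw [Finset.sum_comm]
  simp only [← Finset.sum_smul, chr_mul_pow_add hp, ← Finset.mul_sum]
  have hdvd : ∀ s : ℕ, (p : ℤ) ∣ -(s : ℤ) ↔ p ∣ s := fun s => by
    rw [dvd_neg, Int.natCast_dvd_natCast]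
  simp only [sum_range_e hp, hdvd]
  -- Only multiples of `p` survive, each with weight `p`, which cancels one factor of the
  -- normalisation `p ^ (-(N + 1))`.
  rw [pow_succ' p, sum_range_mul, Finset.sum_eq_single 0]
  · rw [pow_succ', mul_inv, mul_comm _⁻¹, mul_smul]
    congr 1
    rw [Finset.smul_sum]
    refine Finset.sum_congr rfl fun t _ => ?_
    rw [zero_add, if_pos (dvd_mul_left p t), smul_smul, mul_comm (chr _ _ _ _),
      inv_mul_cancel_left₀ hp', mul_comm t p]
    congr 1
    rw [chr, chr]
    congr 2
    push_cast
    field_simp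
    ring
  · intro r hr hr0
    refine Finset.sum_eq_zero fun t _ => ?_
    rw [if_neg, mul_zero, zero_smul]
    intro h
    rw [Nat.dvd_add_left (dvd_mul_left p t)] at h
    exact hr0 (Nat.eq_zero_of_dvd_of_lt h (Finset.mem_range.1 hr))
  · intro h
    exact absurd (Finset.mem_range.2 hp) h

/-- The finite Fourier expansion of level `M` recovers the sequence up to its oscillation on
residue classes modulo `p ^ M`. -/
theorem norm_sum_fourier_sub_le {p M : ℕ} (hp : 0 < p) {f : ℕ → E} {c : ℕ → E}
    (hc : ∀ l, Tendsto (fun N => avg p N (fun s => chr p M l s • f s)) atTop (𝓝 (c l)))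
    {ε : ℝ} (h : ∀ n j, ‖f (n + j * p ^ M) - f n‖ ≤ ε) (n : ℕ) :
    ‖(∑ l ∈ Finset.range (p ^ M), e ((n : ℝ) * l / (p : ℝ) ^ M) • c l) - f n‖ ≤ 2 * ε := by
  have hlim : Tendsto (fun N => ‖(∑ l ∈ Finset.range (p ^ M), e ((n : ℝ) * l / (p : ℝ) ^ M) •
      avg p N (fun s => chr p M l s • f s)) - f n‖) atTop
      (𝓝 ‖(∑ l ∈ Finset.range (p ^ M), e ((n : ℝ) * l / (p : ℝ) ^ M) • c l) - f n‖) :=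
    ((tendsto_finsetSum _ fun l _ => (hc l).const_smul _).sub_const _).norm
  refine le_of_tendsto hlim ?_
  filter_upwards [eventually_ge_atTop M] with N hN
  have hP : 0 < p ^ M := pow_pos hp M
  have hP' : ((p : ℂ) ^ M) ≠ 0 := pow_ne_zero _ (by exact_mod_cast hp.ne')
  set r₀ := n % p ^ M with hr₀
  -- Inversion on `ℤ / p ^ M`: summing over `l` selects the residue class of `n` and leaves the
  -- average of `f` over it.
  have hval : (∑ l ∈ Finset.range (p ^ M), e ((n : ℝ) * l / (p : ℝ) ^ M) •
      avg p N (fun s => chr p M l s • f s)) =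
      avg p (N - M) (fun t => f (r₀ + t * p ^ M)) := by
    have h1 : ∀ l, avg p N (fun s => chr p M l s • f s) =
        ((p : ℂ) ^ M)⁻¹ • ∑ r ∈ Finset.range (p ^ M), chr p M l r •
          avg p (N - M) (fun t => f (r + t * p ^ M)) := by
      intro l
      rw [avg_eq_avg_of_le hN, avg]
      congr 1
      refine Finset.sum_congr rfl fun r _ => ?_
      simp only [avg, chr_add_mul_pow hp le_rfl, ← Finset.smul_sum]
      rw [smul_comm]
    simp only [h1, Finset.smul_sum, smul_smul]
    rw [Finset.sum_comm]
    simp only [← Finset.sum_smul]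
    rw [Finset.sum_eq_single r₀]
    · have h2 := sum_range_e hP ((n : ℤ) - r₀)
      rw [if_pos ((Nat.modEq_iff_dvd).1 (Nat.mod_modEq n (p ^ M)))] at h2
      have h3 : ∑ l ∈ Finset.range (p ^ M),
          e ((n : ℝ) * l / (p : ℝ) ^ M) * (((p : ℂ) ^ M)⁻¹ * chr p M l r₀) = 1 := by
        rw [← inv_mul_cancel₀ hP']
        push_cast at h2
        rw [← h2, Finset.mul_sum]
        refine Finset.sum_congr rfl fun l _ => ?_
        rw [mul_left_comm, chr, ← e_add]
        congr 2
        ring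
      rw [h3, one_smul]
    · intro r hr hrne
      have h2 := sum_range_e hP ((n : ℤ) - r)
      rw [if_neg] at h2
      · have h3 : ∑ l ∈ Finset.range (p ^ M),
            e ((n : ℝ) * l / (p : ℝ) ^ M) * (((p : ℂ) ^ M)⁻¹ * chr p M l r) = 0 := by
          rw [← mul_zero ((p : ℂ) ^ M)⁻¹, ← h2, Finset.mul_sum]
          refine Finset.sum_congr rfl fun l _ => ?_
          rw [mul_left_comm, chr, ← e_add]
          congr 2
          push_cast
          ring
        rw [h3, zero_smul]
      · intro hd
        have h4 : r ≡ n [MOD p ^ M] := Nat.modEq_iff_dvd.2 hd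
        exact hrne (by rw [hr₀, ← h4, Nat.mod_eq_of_lt (Finset.mem_range.1 hr)])
    · intro h'
      exact absurd (Finset.mem_range.2 (Nat.mod_lt n hP)) h'
  have hn : f n = f (r₀ + n / p ^ M * p ^ M) := by rw [hr₀, Nat.mod_add_div']
  have h5 : ‖avg p (N - M) (fun t => f (r₀ + t * p ^ M)) - f r₀‖ ≤ ε := by
    rw [← avg_const (N := N - M) hp (f r₀), ← avg_sub]
    exact norm_avg_le hp fun t => h r₀ t
  rw [hval, hn]
  calc _ = ‖(avg p (N - M) (fun t => f (r₀ + t * p ^ M)) - f r₀)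
        - (f (r₀ + n / p ^ M * p ^ M) - f r₀)‖ := by congr 1; abel
    _ ≤ ε + ε := (norm_sub_le _ _).trans (add_le_add h5 (h _ _))
    _ = 2 * ε := by ring

/-- Fourier expansion of a `p`-adically uniformly continuous sequence, normalised at `0`. -/
theorem PadicUniformContinuous.tendsto_sum_layer {p : ℕ} (hp : 0 < p) {f : ℕ → E}
    (hf : PadicUniformContinuous p f) {c : ℕ → ℕ → E}
    (hc : ∀ m l, Tendsto (fun N => avg p N (fun s => chr p m l s • f s)) atTop (𝓝 (c m l)))
    (n : ℕ) :
    Tendsto (fun M => ∑ m ∈ Finset.Icc 1 M, ∑ l ∈ layer p m,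
      (e ((n : ℝ) * l / (p : ℝ) ^ m) - 1) • c m l) atTop (𝓝 (f n - f 0)) := by
  have hp' : (p : ℝ) ≠ 0 := by positivity
  -- Index `p * l` at level `m + 1` gives the same character as `l` at level `m`. The part of level
  -- `M + 1` outside the top layer is therefore level `M`, and the layers assemble into one full sum
  -- in `htel`.
  have hcp : ∀ m l, c (m + 1) (p * l) = c m l := by
    intro m l
    refine tendsto_nhds_unique (hc (m + 1) (p * l)) ?_
    have h : ∀ s, chr p (m + 1) (p * l) s = chr p m l s := by
      intro s
      rw [chr, chr]
      congr 2
      push_cast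
      field_simp
      ring
    simpa only [h] using hc m l
  have htel : ∀ M, ∑ m ∈ Finset.Icc 1 M, ∑ l ∈ layer p m,
      (e ((n : ℝ) * l / (p : ℝ) ^ m) - 1) • c m l =
      ∑ l ∈ Finset.range (p ^ M), (e ((n : ℝ) * l / (p : ℝ) ^ M) - 1) • c M l := by
    intro M
    induction M with
    | zero => simp [e_zero]
    | succ M ih =>
      rw [Finset.sum_Icc_succ_top (by omega), ih, sum_range_pow_succ hp, add_comm]
      congr 1
      refine Finset.sum_congr rfl fun l _ => ?_
      rw [hcp]
      congr 3
      push_cast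
      field_simp
      ring
  simp only [htel]
  rw [← tendsto_sub_nhds_zero_iff]
  refine tendsto_zero_of_norm_le fun ε hε => ?_
  -- The expansions at `n` and at `0` each cost twice the oscillation.
  obtain ⟨K, hK⟩ := hf (ε / 4) (by positivity)
  refine ⟨K, fun M hM => ?_⟩
  have hM' : ∀ n j, ‖f (n + j * p ^ M) - f n‖ ≤ ε / 4 := by
    intro n j
    obtain ⟨Q, rfl⟩ := Nat.exists_eq_add_of_le hM
    have := hK n (j * p ^ Q)
    rwa [mul_assoc, ← pow_add, add_comm Q] at this
  have h1 := norm_sum_fourier_sub_le hp (hc M) hM' n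
  have h0 := norm_sum_fourier_sub_le hp (hc M) hM' 0
  simp only [Nat.cast_zero, zero_mul, zero_div, e_zero] at h0
  simp only [sub_smul, Finset.sum_sub_distrib]
  rw [sub_sub_sub_comm]
  refine (norm_sub_le _ _).trans ?_
  linarith

end Average

/-! ### The scaling function -/

theorem typeIIScaling_pos {p : ℕ} (hp : p.Prime) (H : ℝ) {n : ℕ} (hn : n ≠ 0) :
    0 < typeIIScaling p H n := by
  have := Fact.mk hp
  refine Real.rpow_pos_of_pos ?_ _
  have h : padicNorm p (n : ℚ) ≠ 0 := padicNorm.nonzero (by exact_mod_cast hn)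
  exact_mod_cast lt_of_le_of_ne (padicNorm.nonneg _) h.symm

theorem typeIIScaling_one {p : ℕ} (H : ℝ) : typeIIScaling p H 1 = 1 := by
  simp [typeIIScaling]

theorem typeIIScaling_mul {p : ℕ} (hp : p.Prime) (H : ℝ) (a b : ℕ) :
    typeIIScaling p H (a * b) = typeIIScaling p H a * typeIIScaling p H b := by
  have := Fact.mk hp
  rw [typeIIScaling, typeIIScaling, typeIIScaling, ← Real.mul_rpow]
  · push_cast
    rw [padicNorm.mul]
    push_cast
    rfl
  · exact_mod_cast padicNorm.nonneg _
  · exact_mod_cast padicNorm.nonneg _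

theorem typeIIScaling_self {p : ℕ} (hp : p.Prime) (H : ℝ) :
    typeIIScaling p H p = (p : ℝ) ^ (-H) := by
  rw [typeIIScaling, padicNorm.padicNorm_p hp.one_lt]
  push_cast
  rw [Real.inv_rpow (Nat.cast_nonneg p), Real.rpow_neg (Nat.cast_nonneg p)]

theorem typeIIScaling_of_coprime {p q : ℕ} (hp : p.Prime) (H : ℝ) (hq : ¬ p ∣ q) :
    typeIIScaling p H q = 1 := by
  have := Fact.mk hp
  rw [typeIIScaling, (padicNorm.nat_eq_one_iff q).2 hq]
  simp

variable {Ω : Type*} [MeasurableSpace Ω] {μ : Measure Ω}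

/-- Self-similarity for multiplicative scaling functions follows from the case of primes. -/
theorem isSelfSimilar_typeIIScaling_of_prime {p : ℕ} (hp : p.Prime) (H : ℝ) {X : ℕ → Ω → ℝ}
    (hX : ∀ n, AEMeasurable (X n) μ)
    (h : ∀ q : ℕ, q.Prime → IdentDistrib (fun ω (m : ℕ) => X (q * m) ω)
      (fun ω (m : ℕ) => typeIIScaling p H q * X m ω) μ μ) :
    IsSelfSimilar μ X (typeIIScaling p H) := by
  intro n hn
  refine ⟨typeIIScaling_pos hp H (by omega), ?_⟩
  induction n using Nat.recOnMul with
  | zero => omega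
  | one =>
    simp only [typeIIScaling_one, one_mul]
    exact IdentDistrib.refl (aemeasurable_pi_lambda _ hX)
  | prime q hq => exact h q hq
  | mul a b iha ihb =>
    have ha := iha (Nat.pos_of_ne_zero (left_ne_zero_of_mul (Nat.ne_of_gt hn)))
    have hb := ihb (Nat.pos_of_ne_zero (right_ne_zero_of_mul (Nat.ne_of_gt hn)))
    have h1 := ha.comp (u := fun (x : ℕ → ℝ) m => x (b * m)) (by fun_prop)
    have h2 := hb.comp (u := fun (x : ℕ → ℝ) m => typeIIScaling p H a * x m) (by fun_prop)
    convert h1.trans h2 using 1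
    · funext ω m
      simp [mul_assoc]
    · funext ω m
      simp [typeIIScaling_mul hp, mul_assoc]

/-- Stationarity of the increments follows from invariance under the unit shift. -/
theorem hasStationaryIncrements_of_succ {X : ℕ → Ω → ℝ} (hX : ∀ n, AEMeasurable (X n) μ)
    (h : IdentDistrib (fun ω (m : ℕ) => X (m + 1) ω - X m ω)
      (fun ω (m : ℕ) => X (m + 1 + 1) ω - X (m + 1) ω) μ μ) :
    HasStationaryIncrements μ X := by
  have h0 : ∀ k : ℕ, IdentDistrib (fun ω (m : ℕ) => X (m + 1) ω - X m ω)
      (fun ω (m : ℕ) => X (m + k + 1) ω - X (m + k) ω) μ μ := by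
    intro k
    induction k with
    | zero => exact IdentDistrib.refl (aemeasurable_pi_lambda _ fun m => (hX _).sub (hX _))
    | succ k ih =>
      have h1 := h.comp (u := fun (x : ℕ → ℝ) m => x (m + k)) (by fun_prop)
      convert ih.trans h1 using 1
      funext ω m
      simp only [Function.comp_apply]
      ring_nf
  exact fun k _ => h0 k

/-! ### From the spectral representation to the process -/

/-- Extension by zero of a family of coefficients. -/
noncomputable def extendIndex {p : ℕ} (a : Index p → ℂ) (m l : ℕ) : ℂ :=
  open Classical in if h : 1 ≤ m ∧ l ∈ layer p m then a ⟨(m, l), h⟩ else 0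

theorem measurable_extendIndex {p : ℕ} (m l : ℕ) :
    Measurable fun a : Index p → ℂ => extendIndex a m l := by
  unfold extendIndex
  split_ifs <;> fun_prop

theorem sum_extendIndex {p : ℕ} (B : ℕ → ℕ → ℂ) (φ : ℕ → ℕ → ℂ) (M : ℕ) :
    ∑ m ∈ Finset.Icc 1 M, ∑ l ∈ layer p m,
      extendIndex (fun i : Index p => B i.1.1 i.1.2) m l * φ m l =
      ∑ m ∈ Finset.Icc 1 M, ∑ l ∈ layer p m, B m l * φ m l := by
  refine Finset.sum_congr rfl fun m hm => Finset.sum_congr rfl fun l hl => ?_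
  rw [extendIndex, dif_pos ⟨(Finset.mem_Icc.1 hm).1, hl⟩]

/-- Two series with the same weights and identically distributed coefficients define identically
distributed processes. -/
theorem identDistrib_of_series {p : ℕ} {B C : ℕ → ℕ → Ω → ℂ}
    (h : IdentDistrib (fun ω (i : Index p) => B i.1.1 i.1.2 ω)
      (fun ω (i : Index p) => C i.1.1 i.1.2 ω) μ μ)
    (φ : ℕ → ℕ → ℕ → ℂ) {Y Z : ℕ → Ω → ℝ}
    (hY : ∀ n, TendstoInMeasure μ (fun M ω => ∑ m ∈ Finset.Icc 1 M, ∑ l ∈ layer p m,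
      B m l ω * φ n m l) atTop (fun ω => (Y n ω : ℂ)))
    (hZ : ∀ n, TendstoInMeasure μ (fun M ω => ∑ m ∈ Finset.Icc 1 M, ∑ l ∈ layer p m,
      C m l ω * φ n m l) atTop (fun ω => (Z n ω : ℂ))) :
    IdentDistrib (fun ω n => Y n ω) (fun ω n => Z n ω) μ μ := by
  have hYZ := identDistrib_of_tendstoInMeasure h
    (G := fun M n a => ∑ m ∈ Finset.Icc 1 M, ∑ l ∈ layer p m, extendIndex a m l * φ n m l)
    (u := fun ω n => (Y n ω : ℂ)) (v := fun ω n => (Z n ω : ℂ))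
    (fun M n => Finset.measurable_sum _ fun m _ => Finset.measurable_sum _ fun l _ =>
      (measurable_extendIndex m l).mul_const _)
    (fun n => by
      have hs := fun ω => sum_extendIndex (p := p) (fun m l => B m l ω) (φ n)
      simpa only [hs] using hY n)
    (fun n => by
      have hs := fun ω => sum_extendIndex (p := p) (fun m l => C m l ω) (φ n)
      simpa only [hs] using hZ n)
  exact hYZ.comp (u := fun (x : ℕ → ℂ) n => (x n).re)
    (measurable_pi_lambda _ fun n => Complex.measurable_re.comp (measurable_pi_apply n))

/-- `X n` is the `L²` limit of the series `∑ A m l * φ m l`. -/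
def HasL2Series (μ : Measure Ω) (p : ℕ) (B : ℕ → ℕ → Ω → ℂ) (φ : ℕ → ℕ → ℂ) (Y : Ω → ℝ) : Prop :=
  Tendsto (fun M : ℕ => eLpNorm (fun ω => (Y ω : ℂ) - ∑ m ∈ Finset.Icc 1 M, ∑ l ∈ layer p m,
    B m l ω * φ m l) 2 μ) atTop (𝓝 0)

theorem aestronglyMeasurable_series {p : ℕ} {B : ℕ → ℕ → Ω → ℂ}
    (hB : ∀ i : Index p, AEStronglyMeasurable (B i.1.1 i.1.2) μ) (φ : ℕ → ℕ → ℂ) (M : ℕ) :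
    AEStronglyMeasurable (fun ω => ∑ m ∈ Finset.Icc 1 M, ∑ l ∈ layer p m, B m l ω * φ m l) μ :=
  Finset.aestronglyMeasurable_fun_sum _ fun m hm => Finset.aestronglyMeasurable_fun_sum _
    fun l hl => (hB ⟨(m, l), (Finset.mem_Icc.1 hm).1, hl⟩).mul_const _

theorem HasL2Series.tendstoInMeasure {p : ℕ} {B : ℕ → ℕ → Ω → ℂ} {φ : ℕ → ℕ → ℂ} {Y : Ω → ℝ}
    (h : HasL2Series μ p B φ Y) (hB : ∀ i : Index p, AEStronglyMeasurable (B i.1.1 i.1.2) μ)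
    (hY : AEMeasurable Y μ) :
    TendstoInMeasure μ (fun M ω => ∑ m ∈ Finset.Icc 1 M, ∑ l ∈ layer p m,
      B m l ω * φ m l) atTop (fun ω => (Y ω : ℂ)) := by
  refine tendstoInMeasure_of_tendsto_eLpNorm two_ne_zero (aestronglyMeasurable_series hB φ)
    (Complex.continuous_ofReal.comp_aestronglyMeasurable hY.aestronglyMeasurable) ?_
  refine h.congr fun M => ?_
  rw [← eLpNorm_neg]
  congr 1
  funext ω
  simp

theorem HasL2Series.sub {p : ℕ} {B : ℕ → ℕ → Ω → ℂ} {φ ψ : ℕ → ℕ → ℂ} {Y Z : Ω → ℝ}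
    (hB : ∀ i : Index p, AEStronglyMeasurable (B i.1.1 i.1.2) μ)
    (hYm : AEMeasurable Y μ) (hZm : AEMeasurable Z μ)
    (hY : HasL2Series μ p B φ Y) (hZ : HasL2Series μ p B ψ Z) :
    HasL2Series μ p B (fun m l => φ m l - ψ m l) (fun ω => Y ω - Z ω) := by
  have h := hY.add hZ
  rw [add_zero] at h
  refine tendsto_of_tendsto_of_tendsto_of_le_of_le tendsto_const_nhds h (fun _ => zero_le)
    fun M => ?_
  refine le_trans (le_of_eq ?_) (eLpNorm_sub_le
    ((Complex.continuous_ofReal.comp_aestronglyMeasurable hYm.aestronglyMeasurable).sub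
      (aestronglyMeasurable_series hB φ M))
    ((Complex.continuous_ofReal.comp_aestronglyMeasurable hZm.aestronglyMeasurable).sub
      (aestronglyMeasurable_series hB ψ M)) one_le_two)
  congr 1
  funext ω
  simp only [Pi.sub_apply, mul_sub, Finset.sum_sub_distrib, Complex.ofReal_sub]
  ring

theorem HasL2Series.const_mul {p : ℕ} {B : ℕ → ℕ → Ω → ℂ} {φ : ℕ → ℕ → ℂ} {Y : Ω → ℝ}
    (hY : HasL2Series μ p B φ Y) (c : ℝ) :
    HasL2Series μ p (fun m l ω => (c : ℂ) * B m l ω) φ (fun ω => c * Y ω) := by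
  have h := ENNReal.Tendsto.const_mul (a := ‖(c : ℂ)‖ₑ) hY (Or.inr enorm_ne_top)
  rw [mul_zero] at h
  refine h.congr fun M => ?_
  rw [← eLpNorm_const_smul]
  congr 1
  funext ω
  simp only [Pi.smul_apply, smul_eq_mul, mul_sub, Finset.mul_sum, mul_assoc, Complex.ofReal_mul]

theorem HasL2Series.mul_mod {p q : ℕ} (hp : p.Prime) (hq : Nat.Coprime q p)
    {A : ℕ → ℕ → Ω → ℂ} {n : ℕ} {Y : Ω → ℝ}
    (h : HasL2Series μ p A (fun m l => e ((n : ℝ) * l / (p : ℝ) ^ m) - 1) Y) :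
    HasL2Series μ p (fun m l ω => A m (q * l % p ^ m) ω)
      (fun m l => e (((q * n : ℕ) : ℝ) * l / (p : ℝ) ^ m) - 1) Y := by
  refine h.congr fun M => ?_
  congr 1
  funext ω
  congr 1
  refine Finset.sum_congr rfl fun m hm => ?_
  rw [← sum_layer_mul_mod hp hq (Finset.mem_Icc.1 hm).1]
  refine Finset.sum_congr rfl fun l _ => ?_
  congr 1
  simp only [sub_left_inj]
  refine e_eq_of_sub_eq_intCast (-(n * (q * l / p ^ m) : ℕ) : ℤ) ?_
  have hp' : (p : ℝ) ^ m ≠ 0 := pow_ne_zero _ (by exact_mod_cast hp.ne_zero)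
  have h1 : ((q * l % p ^ m : ℕ) : ℝ) + (p : ℝ) ^ m * ((q * l / p ^ m : ℕ) : ℝ) = q * l := by
    exact_mod_cast Nat.mod_add_div (q * l) (p ^ m)
  generalize q * l / p ^ m = c at h1 ⊢
  push_cast
  rw [← sub_div, div_eq_iff hp']
  linear_combination (n : ℝ) * h1

/-- Passing from `n` to `p * n` lowers every level by one: the characters of layer `1` become
trivial and drop out, and layer `m + 1` folds `p`-to-one onto layer `m`. -/
theorem HasL2Series.sum_lift {p : ℕ} (hp : p.Prime) {A : ℕ → ℕ → Ω → ℂ} {n : ℕ} {Y : Ω → ℝ}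
    (h : HasL2Series μ p A (fun m l => e (((p * n : ℕ) : ℝ) * l / (p : ℝ) ^ m) - 1) Y) :
    HasL2Series μ p (fun m l ω => ∑ t ∈ Finset.range p, A (m + 1) (t * p ^ m + l) ω)
      (fun m l => e ((n : ℝ) * l / (p : ℝ) ^ m) - 1) Y := by
  refine (h.comp (tendsto_add_atTop_nat 1)).congr fun M => ?_
  have hp' : (p : ℝ) ≠ 0 := by exact_mod_cast hp.ne_zero
  simp only [Function.comp_apply]
  congr 1
  funext ω
  congr 1
  have hterm : ∀ m, 1 ≤ m → ∑ l ∈ layer p (m + 1),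
      A (m + 1) l ω * (e (((p * n : ℕ) : ℝ) * l / (p : ℝ) ^ (m + 1)) - 1) =
      ∑ l ∈ layer p m, (∑ t ∈ Finset.range p, A (m + 1) (t * p ^ m + l) ω) *
        (e ((n : ℝ) * l / (p : ℝ) ^ m) - 1) := by
    intro m hm
    rw [sum_layer_succ hm]
    refine Finset.sum_congr rfl fun l _ => ?_
    rw [Finset.sum_mul]
    refine Finset.sum_congr rfl fun t _ => ?_
    congr 2
    refine e_eq_of_sub_eq_intCast (n * t : ℕ) ?_
    push_cast
    field_simp
    ring
  have hone : ∑ l ∈ layer p 1,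
      A 1 l ω * (e (((p * n : ℕ) : ℝ) * l / (p : ℝ) ^ 1) - 1) = 0 := by
    refine Finset.sum_eq_zero fun l _ => ?_
    rw [e_eq_one_iff.2 ⟨(n * l : ℕ), ?_⟩, sub_self, mul_zero]
    push_cast
    field_simp
  induction M with
  | zero => simpa using hone
  | succ M ih =>
    rw [Finset.sum_Icc_succ_top (by omega), ih, Finset.sum_Icc_succ_top (by omega),
      hterm _ (by omega)]

/-- With `x = l / p ^ m`, one has `e ((n+2) x) - e ((n+1) x) = e x * (e ((n+1) x) - e (n x))`; the
phase moves to the coefficient. -/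
theorem HasL2Series.rotate {p : ℕ} {A : ℕ → ℕ → Ω → ℂ} {n : ℕ} {Y : Ω → ℝ}
    (h : HasL2Series μ p A (fun m l => (e (((n + 1 + 1 : ℕ) : ℝ) * l / (p : ℝ) ^ m) - 1) -
      (e (((n + 1 : ℕ) : ℝ) * l / (p : ℝ) ^ m) - 1)) Y) :
    HasL2Series μ p (fun m l ω => e ((l : ℝ) / (p : ℝ) ^ m) * A m l ω)
      (fun m l => (e (((n + 1 : ℕ) : ℝ) * l / (p : ℝ) ^ m) - 1) -
        (e ((n : ℝ) * l / (p : ℝ) ^ m) - 1)) Y := by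
  refine h.congr fun M => ?_
  congr 1
  funext ω
  congr 1
  refine Finset.sum_congr rfl fun m _ => Finset.sum_congr rfl fun l _ => ?_
  have hs : ∀ k : ℕ, e (((k + 1 : ℕ) : ℝ) * l / (p : ℝ) ^ m) =
      e ((k : ℝ) * l / (p : ℝ) ^ m) * e ((l : ℝ) / (p : ℝ) ^ m) := by
    intro k
    rw [← e_add]
    congr 1
    push_cast
    ring
  simp only [hs]
  ring

/-- A process with a spectral representation is self-similar with stationary increments. -/
theorem isDtSsSi_of_series {p : ℕ} (hp : p.Prime) {H : ℝ} {X : ℕ → Ω → ℝ}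
    (hX : ∀ n, AEMeasurable (X n) μ) {A : ℕ → ℕ → Ω → ℂ}
    (hA : ∀ i : Index p, AEStronglyMeasurable (A i.1.1 i.1.2) μ)
    (hser : ∀ n : ℕ, HasL2Series μ p A (fun m l => e ((n : ℝ) * l / (p : ℝ) ^ m) - 1) (X n))
    (hrot : IdentDistrib (fun ω (i : Index p) => A i.1.1 i.1.2 ω)
      (fun ω (i : Index p) => e ((i.1.2 : ℝ) / (p : ℝ) ^ i.1.1) * A i.1.1 i.1.2 ω) μ μ)
    (hmul : ∀ q : ℕ, q.Prime → q ≠ p → IdentDistrib (fun ω (i : Index p) => A i.1.1 i.1.2 ω)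
      (fun ω (i : Index p) => A i.1.1 ((q * i.1.2) % p ^ i.1.1) ω) μ μ)
    (hscale : IdentDistrib
      (fun ω (i : Index p) => (((p : ℝ) ^ (-H) : ℝ) : ℂ) * A i.1.1 i.1.2 ω)
      (fun ω (i : Index p) =>
        ∑ t ∈ Finset.range p, A (i.1.1 + 1) (t * p ^ i.1.1 + i.1.2) ω) μ μ) :
    IsDtSsSi μ X (typeIIScaling p H) := by
  refine ⟨isSelfSimilar_typeIIScaling_of_prime hp H hX fun q hq => ?_,
    hasStationaryIncrements_of_succ hX ?_⟩
  · by_cases hqp : q = p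
    · subst hqp
      rw [typeIIScaling_self hp]
      refine (identDistrib_of_series (B := fun m l ω => (((q : ℝ) ^ (-H) : ℝ) : ℂ) * A m l ω)
        (C := fun m l ω => ∑ t ∈ Finset.range q, A (m + 1) (t * q ^ m + l) ω) hscale
        (fun n m l => e ((n : ℝ) * l / (q : ℝ) ^ m) - 1)
        (Y := fun n ω => (q : ℝ) ^ (-H) * X n ω) (Z := fun n => X (q * n)) ?_ ?_).symm
      · exact fun n => ((hser n).const_mul _).tendstoInMeasure (fun i => (hA i).const_mul _)
          ((hX n).const_mul _)
      · exact fun n => ((hser (q * n)).sum_lift hp).tendstoInMeasure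
          (fun i => Finset.aestronglyMeasurable_fun_sum _ fun t ht =>
            hA ⟨(i.1.1 + 1, t * q ^ i.1.1 + i.1.2), by simp,
              add_mem_layer i.2.1 (Finset.mem_range.1 ht) i.2.2⟩) (hX _)
    · have hcop : Nat.Coprime q p := (Nat.coprime_primes hq hp).2 hqp
      rw [typeIIScaling_of_coprime hp H ((Nat.Prime.coprime_iff_not_dvd hp).1 hcop.symm)]
      simp only [one_mul]
      refine identDistrib_of_series (B := A)
        (C := fun m l ω => A m (q * l % p ^ m) ω) (hmul q hq hqp)
        (fun n m l => e (((q * n : ℕ) : ℝ) * l / (p : ℝ) ^ m) - 1)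
        (Y := fun n => X (q * n)) (Z := X) ?_ ?_
      · exact fun n => (hser (q * n)).tendstoInMeasure hA (hX _)
      · exact fun n => ((hser n).mul_mod hp hcop).tendstoInMeasure
          (fun i => hA ⟨(i.1.1, q * i.1.2 % p ^ i.1.1), i.2.1, mul_mod_mem_layer hp hcop i.2.1 i.2.2⟩) (hX n)
  · refine identDistrib_of_series (B := A)
      (C := fun m l ω => e ((l : ℝ) / (p : ℝ) ^ m) * A m l ω) hrot
      (fun n m l => (e (((n + 1 : ℕ) : ℝ) * l / (p : ℝ) ^ m) - 1) -
        (e ((n : ℝ) * l / (p : ℝ) ^ m) - 1))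
      (Y := fun n ω => X (n + 1) ω - X n ω) (Z := fun n ω => X (n + 1 + 1) ω - X (n + 1) ω)
      ?_ ?_
    · exact fun n => ((hser (n + 1)).sub hA (hX _) (hX _) (hser n)).tendstoInMeasure hA
        ((hX _).sub (hX _))
    · exact fun n => (((hser (n + 1 + 1)).sub hA (hX _) (hX _)
        (hser (n + 1))).rotate).tendstoInMeasure (fun i => (hA i).const_mul _)
        ((hX _).sub (hX _))

/-! ### Second-order properties of self-similar processes with stationary increments -/

/-- A random variable distributed as a strict contraction of itself vanishes. -/
theorem ae_eq_zero_of_identDistrib_const_mul [IsFiniteMeasure μ] {Z : Ω → ℝ} {c : ℝ}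
    (hc0 : 0 ≤ c) (hc1 : c < 1) (h : IdentDistrib Z (fun ω => c * Z ω) μ μ) : Z =ᵐ[μ] 0 := by
  have hk : ∀ k : ℕ, IdentDistrib Z (fun ω => c ^ k * Z ω) μ μ := by
    intro k
    induction k with
    | zero => simpa using IdentDistrib.refl h.aemeasurable_fst
    | succ k ih =>
      have := h.trans (ih.const_mul c)
      simpa only [pow_succ', mul_assoc] using this
  have hlim : TendstoInMeasure μ (fun (k : ℕ) ω => c ^ k * Z ω) atTop (0 : Ω → ℝ) := by
    refine tendstoInMeasure_of_tendsto_ae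
      (fun k => (hk k).aemeasurable_snd.aestronglyMeasurable) (ae_of_all _ fun ω => ?_)
    simpa using (tendsto_pow_atTop_nhds_zero_of_lt_one hc0 hc1).mul_const (Z ω)
  -- The tail probabilities of `Z` equal those of `c ^ k * Z` for every `k`, and the latter tend to
  -- `0`.
  have hconst : TendstoInMeasure μ (fun (_ : ℕ) => Z) atTop (0 : Ω → ℝ) := by
    intro ε hε
    refine (hlim ε hε).congr fun k => ?_
    exact ((hk k).measure_mem_eq (s := {x | ε ≤ edist x 0})
      (measurableSet_le measurable_const (by fun_prop))).symm
  have hself : TendstoInMeasure μ (fun (_ : ℕ) => Z) atTop Z := by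
    intro ε hε
    simp [hε.ne']
  exact tendstoInMeasure_ae_unique hself hconst

/-- Partial sums of the increments telescope, so the law of the increments fixes that of the path
relative to its start. -/
theorem HasStationaryIncrements.identDistrib_sub {X : ℕ → Ω → ℝ}
    (h : HasStationaryIncrements μ X) (hX : ∀ n, AEMeasurable (X n) μ) (k : ℕ) :
    IdentDistrib (fun ω (n : ℕ) => X n ω - X 0 ω) (fun ω (n : ℕ) => X (n + k) ω - X k ω) μ μ := by
  rcases Nat.eq_zero_or_pos k with rfl | hk
  · exact IdentDistrib.refl (aemeasurable_pi_lambda _ fun n => (hX _).sub (hX _))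
  · have h1 := (h k hk).comp (u := fun (x : ℕ → ℝ) n => ∑ j ∈ Finset.range n, x j) (by fun_prop)
    convert h1 using 1
    · funext ω n
      exact (Finset.sum_range_sub (fun j => X j ω) n).symm
    · funext ω n
      have := Finset.sum_range_sub (fun j => X (j + k) ω) n
      simp only [zero_add, Nat.add_right_comm _ 1 k] at this
      exact this.symm

theorem IsSelfSimilar.ae_eq_zero [IsFiniteMeasure μ] {p : ℕ} (hp : p.Prime) {H : ℝ} (hH : 0 < H)
    {X : ℕ → Ω → ℝ} (h : IsSelfSimilar μ X (typeIIScaling p H)) : X 0 =ᵐ[μ] 0 := by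
  have h1 := (h p hp.one_le).2.comp (u := fun (x : ℕ → ℝ) => x 0) (by fun_prop)
  rw [typeIIScaling_self hp] at h1
  exact ae_eq_zero_of_identDistrib_const_mul (by positivity)
    (Real.rpow_lt_one_of_one_lt_of_neg (by exact_mod_cast hp.one_lt) (by linarith)) h1

theorem IsSelfSimilar.identDistrib_one {b : ℕ → ℝ} {X : ℕ → Ω → ℝ} (h : IsSelfSimilar μ X b)
    {n : ℕ} (hn : 1 ≤ n) : IdentDistrib (X n) (fun ω => b n * X 1 ω) μ μ := by
  simpa [Function.comp_def] using (h n hn).2.comp (u := fun (x : ℕ → ℝ) => x 1) (by fun_prop)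

theorem IsSelfSimilar.memLp [IsFiniteMeasure μ] {p : ℕ} (hp : p.Prime) {H : ℝ} (hH : 0 < H)
    {X : ℕ → Ω → ℝ} (h : IsSelfSimilar μ X (typeIIScaling p H)) (hX1 : MemLp (X 1) 2 μ) (n : ℕ) :
    MemLp (X n) 2 μ := by
  rcases Nat.eq_zero_or_pos n with rfl | hn
  · exact (memLp_congr_ae (h.ae_eq_zero hp hH)).2 MemLp.zero
  · exact (h.identDistrib_one hn).symm.memLp_snd (hX1.const_mul _)

/-- The variogram of a self-similar process with stationary increments. -/
theorem IsDtSsSi.eLpNorm_sub [IsFiniteMeasure μ] {p : ℕ} (hp : p.Prime) {H : ℝ} (hH : 0 < H)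
    {X : ℕ → Ω → ℝ} (hX : ∀ n, AEMeasurable (X n) μ) (h : IsDtSsSi μ X (typeIIScaling p H))
    (n : ℕ) {d : ℕ} (hd : 1 ≤ d) :
    eLpNorm (fun ω => X (n + d) ω - X n ω) 2 μ =
      ENNReal.ofReal (typeIIScaling p H d) * eLpNorm (X 1) 2 μ := by
  have h1 := (h.2.identDistrib_sub hX n).comp (u := fun (x : ℕ → ℝ) => x d) (by fun_prop)
  have h2 : eLpNorm (fun ω => X (n + d) ω - X n ω) 2 μ = eLpNorm (X d) 2 μ := by
    rw [show (fun ω => X (n + d) ω - X n ω) = (fun ω => X (d + n) ω - X n ω) by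
      rw [add_comm], ← show _ = eLpNorm (fun ω => X (d + n) ω - X n ω) 2 μ from h1.eLpNorm_eq 2]
    refine eLpNorm_congr_ae ?_
    filter_upwards [h.1.ae_eq_zero hp hH] with ω hω
    simp [hω]
  rw [h2, (h.1.identDistrib_one hd).eLpNorm_eq]
  have h3 := eLpNorm_const_smul (typeIIScaling p H d) (X 1) 2 μ
  rw [Real.enorm_of_nonneg (typeIIScaling_pos hp H (by omega)).le] at h3
  exact h3

/-! ### Linear combinations in `L²` -/

theorem coeFn_sum_smul {ι : Type*} (s : Finset ι) (w : ι → ℂ) (y : ι → Lp ℂ 2 μ) :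
    ⇑(∑ i ∈ s, w i • y i) =ᵐ[μ] fun ω => ∑ i ∈ s, w i * y i ω := by
  refine (Lp.coeFn_fun_finsetSum s _).trans ?_
  have h : ∀ᵐ ω ∂μ, ∀ i ∈ s, (w i • y i) ω = w i * y i ω :=
    (Finset.eventually_all s).2 fun i _ => Lp.coeFn_smul (w i) (y i)
  filter_upwards [h] with ω hω using Finset.sum_congr rfl hω

theorem tendstoInMeasure_avg {p : ℕ} {w : ℕ → ℂ} {Y : ℕ → Ω → ℝ} {y : ℕ → Lp ℂ 2 μ} {d : Lp ℂ 2 μ}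
    (hy : ∀ n, y n =ᵐ[μ] fun ω => (Y n ω : ℂ))
    (h : Tendsto (fun N => avg p N (fun s => w s • y s)) atTop (𝓝 d)) :
    TendstoInMeasure μ (fun N ω => avg p N (fun s => w s * (Y s ω : ℂ))) atTop d := by
  refine (tendstoInMeasure_of_tendsto_Lp h).congr_left fun N => ?_
  refine (Lp.coeFn_smul _ _).trans ?_
  filter_upwards [coeFn_sum_smul (Finset.range (p ^ N)) w y, ae_all_iff.2 hy] with ω h1 h2
  simp only [Pi.smul_apply, h1, avg, h2]

theorem measurable_avg_mul (p N : ℕ) (w : ℕ → ℂ) :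
    Measurable fun u : ℕ → ℝ => avg p N (fun s => w s * (u s : ℂ)) := by
  unfold avg
  fun_prop

/-- Identically distributed processes have identically distributed Fourier coefficients. -/
theorem identDistrib_of_tendsto_avg {p : ℕ} {ι : Type*} [Countable ι] {w : ι → ℕ → ℂ}
    {Y Z : ℕ → Ω → ℝ} (hYZ : IdentDistrib (fun ω n => Y n ω) (fun ω n => Z n ω) μ μ)
    {y z : ℕ → Lp ℂ 2 μ} (hy : ∀ n, y n =ᵐ[μ] fun ω => (Y n ω : ℂ))
    (hz : ∀ n, z n =ᵐ[μ] fun ω => (Z n ω : ℂ)) {c d : ι → Lp ℂ 2 μ}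
    (hc : ∀ i, Tendsto (fun N => avg p N (fun s => w i s • y s)) atTop (𝓝 (c i)))
    (hd : ∀ i, Tendsto (fun N => avg p N (fun s => w i s • z s)) atTop (𝓝 (d i))) :
    IdentDistrib (fun ω i => c i ω) (fun ω i => d i ω) μ μ :=
  identDistrib_of_tendstoInMeasure hYZ (G := fun N i u => avg p N (fun s => w i s * (u s : ℂ)))
    (fun N i => measurable_avg_mul p N (w i)) (fun i => tendstoInMeasure_avg hy (hc i))
    (fun i => tendstoInMeasure_avg hz (hd i))

theorem identDistrib_congr_ae {ι : Type*} [Countable ι] {a b a' b' : ι → Ω → ℂ}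
    (h : IdentDistrib (fun ω i => a i ω) (fun ω i => b i ω) μ μ)
    (ha : ∀ i, a i =ᵐ[μ] a' i) (hb : ∀ i, b i =ᵐ[μ] b' i) :
    IdentDistrib (fun ω i => a' i ω) (fun ω i => b' i ω) μ μ := by
  refine ((IdentDistrib.of_ae_eq h.aemeasurable_fst ?_).symm.trans h).trans
    (IdentDistrib.of_ae_eq h.aemeasurable_snd ?_)
  · filter_upwards [ae_all_iff.2 ha] with ω hω using funext hω
  · filter_upwards [ae_all_iff.2 hb] with ω hω using funext hω

/-! ### The spectral representation -/

theorem norm_toLp_sub {X : ℕ → Ω → ℝ} {x : ℕ → Lp ℂ 2 μ}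
    (hx : ∀ n, x n =ᵐ[μ] fun ω => (X n ω : ℂ)) (a b : ℕ) :
    ‖x a - x b‖ = (eLpNorm (fun ω => X a ω - X b ω) 2 μ).toReal := by
  rw [Lp.norm_def]
  congr 1
  refine eLpNorm_congr_norm_ae ?_
  filter_upwards [hx a, hx b, Lp.coeFn_sub (x a) (x b)] with ω ha hb hab
  rw [hab, Pi.sub_apply, ha, hb, ← Complex.ofReal_sub, Complex.norm_real]

/-- A self-similar process with stationary increments is `p`-adically uniformly continuous
in `L²`. -/
theorem IsDtSsSi.padicUniformContinuous [IsFiniteMeasure μ] {p : ℕ} (hp : p.Prime) {H : ℝ}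
    (hH : 0 < H) {X : ℕ → Ω → ℝ} (hX : ∀ n, AEMeasurable (X n) μ)
    (h : IsDtSsSi μ X (typeIIScaling p H)) {x : ℕ → Lp ℂ 2 μ}
    (hx : ∀ n, x n =ᵐ[μ] fun ω => (X n ω : ℂ)) : PadicUniformContinuous p x := by
  have := Fact.mk hp
  intro ε hε
  set C := (eLpNorm (X 1) 2 μ).toReal with hC
  have hr1 : (p : ℝ) ^ (-H) < 1 :=
    Real.rpow_lt_one_of_one_lt_of_neg (by exact_mod_cast hp.one_lt) (by linarith)
  -- A step `j * p ^ K` with `j ≥ 1` has `L²` increment at most `p ^ (-H K) * C`, because `|j|_p ≤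
  -- 1`.
  have hlim : Tendsto (fun K : ℕ => ((p : ℝ) ^ (-H)) ^ K * C) atTop (𝓝 0) := by
    simpa using (tendsto_pow_atTop_nhds_zero_of_lt_one (by positivity) hr1).mul_const C
  obtain ⟨K, hK⟩ := (hlim.eventually_le_const hε).exists
  refine ⟨K, fun n j => ?_⟩
  rcases Nat.eq_zero_or_pos j with rfl | hj
  · simpa using hε.le
  have hpos : 1 ≤ j * p ^ K := Nat.mul_pos hj (pow_pos hp.pos K)
  have hpow : ∀ K : ℕ, typeIIScaling p H (p ^ K) = ((p : ℝ) ^ (-H)) ^ K := by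
    intro K
    induction K with
    | zero => simp [typeIIScaling_one]
    | succ K ih => rw [pow_succ, typeIIScaling_mul hp, ih, typeIIScaling_self hp, pow_succ]
  have hle : typeIIScaling p H j ≤ 1 := by
    refine Real.rpow_le_one ?_ ?_ hH.le
    · exact_mod_cast padicNorm.nonneg _
    · exact_mod_cast padicNorm.of_nat j
  rw [norm_toLp_sub hx, h.eLpNorm_sub hp hH hX n hpos, ENNReal.toReal_mul,
    ENNReal.toReal_ofReal (typeIIScaling_pos hp H (by omega)).le, typeIIScaling_mul hp, hpow]
  refine le_trans ?_ hK
  exact mul_le_mul_of_nonneg_right (mul_le_of_le_one_left (by positivity) hle)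
    ENNReal.toReal_nonneg

theorem chr_mul (p m l q s : ℕ) : chr p m l (q * s) = chr p m (q * l) s := by
  rw [chr, chr]
  congr 2
  push_cast
  ring

theorem chr_mod {p : ℕ} (hp : 0 < p) (m l s : ℕ) : chr p m (l % p ^ m) s = chr p m l s := by
  have hp' : (p : ℝ) ^ m ≠ 0 := by positivity
  have h1 : ((l % p ^ m : ℕ) : ℝ) + (p : ℝ) ^ m * ((l / p ^ m : ℕ) : ℝ) = l := by
    exact_mod_cast Nat.mod_add_div l (p ^ m)
  refine e_eq_of_sub_eq_intCast ((s * (l / p ^ m) : ℕ) : ℤ) ?_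
  generalize l / p ^ m = c at h1 ⊢
  push_cast
  rw [← neg_div, ← neg_div, ← sub_div, div_eq_iff hp']
  linear_combination -(s : ℝ) * h1

theorem chr_succ (p m l s : ℕ) :
    chr p m l s = e ((l : ℝ) / (p : ℝ) ^ m) * chr p m l (s + 1) := by
  rw [chr, chr, ← e_add]
  congr 1
  push_cast
  ring

theorem not_pow_dvd_of_mem_layer {p m l : ℕ} (hl : l ∈ layer p m) : ¬ p ^ m ∣ l := by
  rw [layer, Finset.mem_filter, Finset.mem_Ioo] at hl
  exact Nat.not_dvd_of_pos_of_lt hl.1.1 hl.1.2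

/-- A nontrivial character sums to zero over full periods. Coefficients thus see only differences
such as `X n - X 0`, which is all that stationary increments control. -/
theorem avg_chr_smul_sub_const {E : Type*} [NormedAddCommGroup E] [NormedSpace ℂ E] {p m l N : ℕ}
    (hp : 0 < p) (hm : m ≤ N) (hl : ¬ p ^ m ∣ l) (f : ℕ → E) (a : E) :
    avg p N (fun s => chr p m l s • (f s - a)) = avg p N (fun s => chr p m l s • f s) := by
  simp only [smul_sub, avg_sub]
  have : avg p N (fun s => chr p m l s • a) = 0 := by
    rw [avg, ← Finset.sum_smul, sum_range_chr hp hm hl, zero_smul, smul_zero]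
  rw [this, sub_zero]

section Coefficients

variable {p : ℕ} {X : ℕ → Ω → ℝ} {x : ℕ → Lp ℂ 2 μ} {c : ℕ → ℕ → Lp ℂ 2 μ}

/-- The limiting average is translation invariant, so shifting the sequence by one multiplies its
coefficients by `e (l / p ^ m)`. -/
theorem HasStationaryIncrements.identDistrib_rotate (hp : p.Prime)
    (h : HasStationaryIncrements μ X) (hX : ∀ n, AEMeasurable (X n) μ)
    (hx : ∀ n, x n =ᵐ[μ] fun ω => (X n ω : ℂ)) (hxc : PadicUniformContinuous p x)
    (hc : ∀ m l, Tendsto (fun N => avg p N (fun s => chr p m l s • x s)) atTop (𝓝 (c m l))) :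
    IdentDistrib (fun ω (i : Index p) => c i.1.1 i.1.2 ω)
      (fun ω (i : Index p) => e ((i.1.2 : ℝ) / (p : ℝ) ^ i.1.1) * c i.1.1 i.1.2 ω) μ μ := by
  have hsub : ∀ a b, ⇑(x a - x b) =ᵐ[μ] fun ω => ((X a ω - X b ω : ℝ) : ℂ) := by
    intro a b
    filter_upwards [hx a, hx b, Lp.coeFn_sub (x a) (x b)] with ω ha hb hab
    rw [hab, Pi.sub_apply, ha, hb, Complex.ofReal_sub]
  refine identDistrib_congr_ae (identDistrib_of_tendsto_avg (p := p) (ι := Index p)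
    (w := fun i => chr p i.1.1 i.1.2) (h.identDistrib_sub hX 1)
    (y := fun n => x n - x 0) (z := fun n => x (n + 1) - x 1)
    (fun n => hsub n 0) (fun n => hsub (n + 1) 1) (c := fun i => c i.1.1 i.1.2)
    (d := fun i => e ((i.1.2 : ℝ) / (p : ℝ) ^ i.1.1) • c i.1.1 i.1.2) ?_ ?_)
    (fun i => EventuallyEq.rfl) fun i => Lp.coeFn_smul _ _
  · rintro ⟨⟨m, l⟩, hm, hl⟩
    refine (hc m l).congr' ?_
    filter_upwards [eventually_ge_atTop m] with N hN
    exact (avg_chr_smul_sub_const hp.pos hN (not_pow_dvd_of_mem_layer hl) _ _).symm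
  · rintro ⟨⟨m, l⟩, hm, hl⟩
    have h1 := (((hxc.chr_smul hp.pos m l).tendsto_avg_succ hp.one_lt (hc m l)).const_smul
      (e ((l : ℝ) / (p : ℝ) ^ m)))
    refine h1.congr' ?_
    filter_upwards [eventually_ge_atTop m] with N hN
    rw [avg_chr_smul_sub_const hp.pos hN (not_pow_dvd_of_mem_layer hl)]
    have hs : ∀ s, chr p m l s • x (s + 1) =
        e ((l : ℝ) / (p : ℝ) ^ m) • chr p m l (s + 1) • x (s + 1) := fun s => by
      rw [smul_smul, ← chr_succ]
    simp only [avg, hs, ← Finset.smul_sum]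
    rw [smul_comm]

theorem IsSelfSimilar.identDistrib_mul_mod {H : ℝ} {q : ℕ} (hp : p.Prime) (hq : q.Prime)
    (hqp : q ≠ p) (h : IsSelfSimilar μ X (typeIIScaling p H))
    (hx : ∀ n, x n =ᵐ[μ] fun ω => (X n ω : ℂ)) (hxc : PadicUniformContinuous p x)
    (hc : ∀ m l, Tendsto (fun N => avg p N (fun s => chr p m l s • x s)) atTop (𝓝 (c m l))) :
    IdentDistrib (fun ω (i : Index p) => c i.1.1 i.1.2 ω)
      (fun ω (i : Index p) => c i.1.1 (q * i.1.2 % p ^ i.1.1) ω) μ μ := by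
  have hcop : Nat.Coprime q p := (Nat.coprime_primes hq hp).2 hqp
  have h1 := (h q hq.one_le).2
  rw [typeIIScaling_of_coprime hp H ((Nat.Prime.coprime_iff_not_dvd hp).1 hcop.symm)] at h1
  simp only [one_mul] at h1
  -- The weights carry the index `q * l`: paired with `x (q * s)` they give `chr p m l` at `q * s`,
  -- hence `c m l`; paired with `x s` they give the permuted coefficient.
  refine identDistrib_of_tendsto_avg (p := p) (ι := Index p)
    (w := fun i => chr p i.1.1 (q * i.1.2 % p ^ i.1.1)) (Y := fun n => X (q * n)) h1
    (y := fun n => x (q * n)) (fun n => hx (q * n)) hx (c := fun i => c i.1.1 i.1.2)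
    (d := fun i => c i.1.1 (q * i.1.2 % p ^ i.1.1)) (fun i => ?_) fun i => hc _ _
  simp only [chr_mod hp.pos, ← chr_mul]
  exact (hxc.chr_smul hp.pos _ _).tendsto_avg_mul hp.pos hcop (hc _ _)

/-- Self-similarity at `p` compares `p ^ (-H) * X m` with `X (p * m)`, whose coefficients are the
sums over lifts by `sum_avg_succ`. -/
theorem IsSelfSimilar.identDistrib_sum_lift {H : ℝ} (hp : p.Prime)
    (h : IsSelfSimilar μ X (typeIIScaling p H)) (hx : ∀ n, x n =ᵐ[μ] fun ω => (X n ω : ℂ))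
    (hc : ∀ m l, Tendsto (fun N => avg p N (fun s => chr p m l s • x s)) atTop (𝓝 (c m l))) :
    IdentDistrib (fun ω (i : Index p) => (((p : ℝ) ^ (-H) : ℝ) : ℂ) * c i.1.1 i.1.2 ω)
      (fun ω (i : Index p) =>
        ∑ t ∈ Finset.range p, c (i.1.1 + 1) (t * p ^ i.1.1 + i.1.2) ω) μ μ := by
  have h1 := (h p hp.one_le).2.symm
  rw [typeIIScaling_self hp] at h1
  set r : ℝ := (p : ℝ) ^ (-H)
  refine identDistrib_congr_ae (identDistrib_of_tendsto_avg (p := p) (ι := Index p)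
    (w := fun i => chr p i.1.1 i.1.2) (Y := fun n ω => r * X n ω) (Z := fun n => X (p * n)) h1
    (y := fun n => (r : ℂ) • x n) (z := fun n => x (p * n)) (fun n => ?_) (fun n => hx _)
    (c := fun i => (r : ℂ) • c i.1.1 i.1.2)
    (d := fun i => ∑ t ∈ Finset.range p, c (i.1.1 + 1) (t * p ^ i.1.1 + i.1.2))
    (fun i => ?_) fun i => ?_) (fun i => Lp.coeFn_smul _ _) fun i => Lp.coeFn_fun_finsetSum _ _
  · filter_upwards [hx n, Lp.coeFn_smul (r : ℂ) (x n)] with ω h1 h2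
    rw [h2, Pi.smul_apply, h1, smul_eq_mul, Complex.ofReal_mul]
  · refine ((hc i.1.1 i.1.2).const_smul (r : ℂ)).congr fun N => ?_
    simp only [avg, Finset.smul_sum, smul_smul]
    refine Finset.sum_congr rfl fun s _ => ?_
    congr 1
    ring
  · simp only [← sum_avg_succ hp.pos]
    exact tendsto_finsetSum _ fun t _ => (hc _ _).comp (tendsto_add_atTop_nat 1)

theorem hasL2Series_of_tendsto (hp : p.Prime) (hx : ∀ n, x n =ᵐ[μ] fun ω => (X n ω : ℂ))
    (hX0 : X 0 =ᵐ[μ] 0) (hxc : PadicUniformContinuous p x)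
    (hc : ∀ m l, Tendsto (fun N => avg p N (fun s => chr p m l s • x s)) atTop (𝓝 (c m l)))
    (n : ℕ) :
    HasL2Series μ p (fun m l => c m l) (fun m l => e ((n : ℝ) * l / (p : ℝ) ^ m) - 1) (X n) := by
  have h := hxc.tendsto_sum_layer hp.pos hc n
  have hx0 : x 0 = 0 := by
    rw [Lp.eq_zero_iff_ae_eq_zero]
    filter_upwards [hx 0, hX0] with ω h1 h2
    simp [h1, h2]
  rw [hx0, sub_zero, Lp.tendsto_Lp_iff_tendsto_eLpNorm'] at h
  refine h.congr fun M => ?_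
  rw [← eLpNorm_neg]
  refine eLpNorm_congr_ae ?_
  simp only [Finset.sum_sigma']
  filter_upwards [hx n, coeFn_sum_smul ((Finset.Icc 1 M).sigma fun m => layer p m)
    (fun i => e ((n : ℝ) * i.2 / (p : ℝ) ^ i.1) - 1) (fun i => c i.1 i.2)] with ω h1 h2
  rw [Pi.neg_apply, Pi.sub_apply, h1, h2, neg_sub]
  simp only [mul_comm]

end Coefficients

/-- Distinct indices give distinct reduced fractions `l / p ^ m` in `(0, 1)`, so their difference is
not an integer. -/
theorem e_div_mul_conj_ne_one {p : ℕ} {i j : Index p} (hij : i ≠ j) :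
    e ((i.1.2 : ℝ) / (p : ℝ) ^ i.1.1) *
      (starRingEnd ℂ) (e ((j.1.2 : ℝ) / (p : ℝ) ^ j.1.1)) ≠ 1 := by
  obtain ⟨⟨m, l⟩, hm, hl⟩ := i
  obtain ⟨⟨m', l'⟩, hm', hl'⟩ := j
  simp only [layer, Finset.mem_filter, Finset.mem_Ioo] at hl hl' hm hm' ⊢
  have hp : 0 < p := by
    rcases Nat.eq_zero_or_pos p with rfl | h
    · simp [zero_pow (by omega : m ≠ 0)] at hl
    · exact h
  have hpm : (0 : ℝ) < (p : ℝ) ^ m := by positivity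
  have hpm' : (0 : ℝ) < (p : ℝ) ^ m' := by positivity
  rw [conj_e, ← e_add]
  intro he
  obtain ⟨k, hk⟩ := e_eq_one_iff.1 he
  have h1 : (l : ℝ) / (p : ℝ) ^ m < 1 := (div_lt_one hpm).2 (by exact_mod_cast hl.1.2)
  have h2 : 0 < (l : ℝ) / (p : ℝ) ^ m := div_pos (by exact_mod_cast hl.1.1) hpm
  have h1' : (l' : ℝ) / (p : ℝ) ^ m' < 1 := (div_lt_one hpm').2 (by exact_mod_cast hl'.1.2)
  have h2' : 0 < (l' : ℝ) / (p : ℝ) ^ m' := div_pos (by exact_mod_cast hl'.1.1) hpm'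
  have hk0 : k = 0 := by
    have ha : (k : ℝ) < 1 := by linarith
    have hb : (-1 : ℝ) < k := by linarith
    have ha' : k < 1 := by exact_mod_cast ha
    have hb' : -1 < k := by exact_mod_cast hb
    omega
  rw [hk0, Int.cast_zero, ← sub_eq_add_neg, sub_eq_zero, div_eq_div_iff hpm.ne' hpm'.ne'] at hk
  have hk' : l * p ^ m' = l' * p ^ m := by exact_mod_cast hk
  -- Unequal exponents would make `p` divide the numerator over the larger power.
  have hmm : m = m' := by
    rcases lt_trichotomy m m' with h | h | h
    · obtain ⟨d, rfl⟩ := Nat.exists_eq_add_of_lt h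
      rw [show p ^ (m + d + 1) = p ^ (d + 1) * p ^ m by ring, ← mul_assoc] at hk'
      have := Nat.eq_of_mul_eq_mul_right (pow_pos hp m) hk'
      exact absurd (this ▸ (dvd_pow_self p (Nat.succ_ne_zero d)).mul_left l) hl'.2
    · exact h
    · obtain ⟨d, rfl⟩ := Nat.exists_eq_add_of_lt h
      rw [show p ^ (m' + d + 1) = p ^ (d + 1) * p ^ m' by ring, ← mul_assoc] at hk'
      have := Nat.eq_of_mul_eq_mul_right (pow_pos hp m') hk'
      exact absurd (this ▸ (dvd_pow_self p (Nat.succ_ne_zero d)).mul_left l') hl.2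
  subst hmm
  have hll : l = l' := Nat.eq_of_mul_eq_mul_right (pow_pos hp m) hk'
  subst hll
  exact hij rfl

/-- Rotation invariance in distribution forces orthogonality. -/
theorem integral_mul_conj_eq_zero {p : ℕ} {A : ℕ → ℕ → Ω → ℂ}
    (h : IdentDistrib (fun ω (i : Index p) => A i.1.1 i.1.2 ω)
      (fun ω (i : Index p) => e ((i.1.2 : ℝ) / (p : ℝ) ^ i.1.1) * A i.1.1 i.1.2 ω) μ μ)
    {i j : Index p} (hij : i ≠ j) :
    ∫ ω, A i.1.1 i.1.2 ω * (starRingEnd ℂ) (A j.1.1 j.1.2 ω) ∂μ = 0 := by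
  have hmeas : Measurable fun a : Index p → ℂ => a i * (starRingEnd ℂ) (a j) :=
    (measurable_pi_apply i).mul (Complex.continuous_conj.measurable.comp (measurable_pi_apply j))
  have h1 := (h.comp hmeas).integral_eq
  simp only [Function.comp_def, map_mul] at h1
  have h2 : ∀ ω, e ((i.1.2 : ℝ) / (p : ℝ) ^ i.1.1) * A i.1.1 i.1.2 ω *
      ((starRingEnd ℂ) (e ((j.1.2 : ℝ) / (p : ℝ) ^ j.1.1)) *
        (starRingEnd ℂ) (A j.1.1 j.1.2 ω)) =
      (e ((i.1.2 : ℝ) / (p : ℝ) ^ i.1.1) *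
        (starRingEnd ℂ) (e ((j.1.2 : ℝ) / (p : ℝ) ^ j.1.1))) *
      (A i.1.1 i.1.2 ω * (starRingEnd ℂ) (A j.1.1 j.1.2 ω)) := fun ω => by ring
  simp only [h2] at h1
  rw [integral_const_mul] at h1
  -- The integral equals itself times a number other than `1`.
  by_contra hne
  exact e_div_mul_conj_ne_one hij (mul_right_cancel₀ hne (by rw [one_mul]; exact h1.symm))

end DtSsSi

theorem theoremt {Ω : Type*} [MeasurableSpace Ω] (μ : Measure Ω) [IsProbabilityMeasure μ]
    (p : ℕ) (hp : p.Prime) (H : ℝ) (hH : 0 < H)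
    (X : ℕ → Ω → ℝ) (hX : ∀ n, AEMeasurable (X n) μ) (hX1 : MemLp (X 1) 2 μ) :
    DtSsSi.IsDtSsSi μ X (DtSsSi.typeIIScaling p H) ↔
      ∃ A : ℕ → ℕ → Ω → ℂ,
        -- the coefficients lie in `L²` and are pairwise orthogonal
        (∀ i : DtSsSi.Index p, MemLp (A i.1.1 i.1.2) 2 μ) ∧
        (∀ i j : DtSsSi.Index p, i ≠ j →
          ∫ ω, A i.1.1 i.1.2 ω * (starRingEnd ℂ) (A j.1.1 j.1.2 ω) ∂μ = 0) ∧
        -- the series converges to the process in `L²`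
        (∀ n : ℕ, Tendsto
          (fun M : ℕ => eLpNorm
            (fun ω => (X n ω : ℂ) - ∑ m ∈ Finset.Icc 1 M, ∑ l ∈ DtSsSi.layer p m,
              A m l ω * (DtSsSi.e ((n : ℝ) * (l : ℝ) / (p : ℝ) ^ m) - 1)) 2 μ)
          atTop (𝓝 0)) ∧
        -- invariance under rotation
        IdentDistrib
          (fun ω (i : DtSsSi.Index p) => A i.1.1 i.1.2 ω)
          (fun ω (i : DtSsSi.Index p) =>
            DtSsSi.e ((i.1.2 : ℝ) / (p : ℝ) ^ i.1.1) * A i.1.1 i.1.2 ω) μ μ ∧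
        -- invariance under multiplication of the index by a prime other than `p`
        (∀ q : ℕ, q.Prime → q ≠ p →
          IdentDistrib
            (fun ω (i : DtSsSi.Index p) => A i.1.1 i.1.2 ω)
            (fun ω (i : DtSsSi.Index p) => A i.1.1 ((q * i.1.2) % p ^ i.1.1) ω) μ μ) ∧
        -- scaling relation between consecutive layers
        IdentDistrib
          (fun ω (i : DtSsSi.Index p) => (((p : ℝ) ^ (-H) : ℝ) : ℂ) * A i.1.1 i.1.2 ω)
          (fun ω (i : DtSsSi.Index p) =>
            ∑ t ∈ Finset.range p, A (i.1.1 + 1) (t * p ^ i.1.1 + i.1.2) ω) μ μ := by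
  constructor
  · intro h
    have hmem : ∀ n, MemLp (fun ω => (X n ω : ℂ)) 2 μ := fun n => (h.1.memLp hp hH hX1 n).ofReal
    have hx : ∀ n, (hmem n).toLp =ᵐ[μ] fun ω => (X n ω : ℂ) := fun n => (hmem n).coeFn_toLp
    have hxc := h.padicUniformContinuous hp hH hX hx
    choose c hc using fun m l => (hxc.chr_smul hp.pos m l).exists_tendsto_avg hp.pos
    have hrot := h.2.identDistrib_rotate hp hX hx hxc hc
    exact ⟨fun m l => c m l, fun i => Lp.memLp _,
      fun i j hij => DtSsSi.integral_mul_conj_eq_zero (A := fun m l => c m l) hrot hij,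
      DtSsSi.hasL2Series_of_tendsto hp hx (h.1.ae_eq_zero hp hH) hxc hc, hrot,
      fun q hq hqp => h.1.identDistrib_mul_mod hp hq hqp hx hxc hc,
      h.1.identDistrib_sum_lift hp hx hc⟩
  · rintro ⟨A, hA, -, hser, hrot, hmul, hscale⟩
    exact DtSsSi.isDtSsSi_of_series hp hX (fun i => (hA i).aestronglyMeasurable) hser hrot hmul
      hscale
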